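/- Let $\Bbbk$ be a field and, for $n\ge 1$, let $R_n=\Bbbk[x_1,\dots,x_n]$. For $n\ge m\ge 1$ let $\mathrm{Inc}_{m,n}$ be the set of strictly increasing maps $\pi$ from the positive integers to the positive integers with $\pi(m)\le n$; such $\pi$ acts as the $\Bbbk$-algebra map $R_m\to R_n$, $x_i\mapsto x_{\pi(i)}$. For an ideal $J\subseteq R_m$ let $\langle \mathrm{Inc}_{m,n}(J)\rangle$ denote the ideal of $R_n$ generated by all $\pi(f)$ with $\pi\in\mathrm{Inc}_{m,n}$, $f\in J$. Let $\mathcal I=(I_n)_{n\ge1}$ be a chain in which each $I_n=\langle x_ix_j \mid \{i,j\}\in E(G_n)\rangle\subseteq R_n$ is the edge ideal of a simple graph $G_n$ on $\{1,\dots,n\}$. Assume that $I_n\ne 0$ for all sufficiently large $n$, and that $\mathcal I$ is $\mathrm{Inc}$-invariant, i.e. $\langle \mathrm{Inc}_{m,n}(I_m)\rangle\subseteq I_n$ for all $n\ge m\ge 1$. Let $r$ be the stability index of $\mathcal I$, i.e. the least $r\ge 1$ such that $\langle \mathrm{Inc}_{m,n}(I_m)\rangle= I_n$ for all $n\ge m\ge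 r$ (such an $r$ always exists). Let $\operatorname{sp}(\mathcal I)=\min\{j-i \mid i<j,\ \{i,j\}\in E(G_r)\}$, and let $\widetilde r=p-i_1+1$, where $i_1$ and $p$ are the smallest and the largest index of a variable dividing some minimal monomial generator of $I_r$. For a finitely generated graded $R_n$-module $M\neq 0$, let $\operatorname{depth}(M)$ be the maximal length of an $M$-regular sequence in $\langle x_1,\dots,x_n\rangle$. Then for all $n\ge r$, \[ \operatorname{depth}(R_n/I_n)\ \ge\ r-\widetilde r+\min\{\operatorname{sp}(\mathcal I),\,2\}. \] -/

import Mathlib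

/-!
Throughout, the polynomial ring `R_n = 𝕜[x_1, …, x_n]` is `MvPolynomial (Fin n) 𝕜`; the variable
`X i` with `i : Fin n` is `x_{i+1}`.
-/

namespace IncChain

section Depth

variable {R : Type*} [CommRing R] (J : Ideal R) (M : Type*) [AddCommGroup M] [Module R M]

/-- The depth of `M` with respect to `J`: the supremum of the lengths of the `M`-regular sequences
all of whose members lie in `J`. -/
noncomputable def depth : ℕ∞ :=
  ⨆ (rs : List R) (_ : (∀ x ∈ rs, x ∈ J) ∧ RingTheory.Sequence.IsRegular M rs), (rs.length : ℕ∞)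

end Depth

/-- The graded maximal ideal `⟨x_1, …, x_n⟩` of `R_n`. -/
noncomputable def maxIdeal (𝕜 : Type*) [Field 𝕜] (n : ℕ) : Ideal (MvPolynomial (Fin n) 𝕜) :=
  Ideal.span (Set.range MvPolynomial.X)

/-- The depth of the `R_n`-module `R_n / J`. -/
noncomputable def depthQuot {𝕜 : Type*} [Field 𝕜] {n : ℕ} (J : Ideal (MvPolynomial (Fin n) 𝕜)) :
    ℕ∞ :=
  depth (maxIdeal 𝕜 n) (MvPolynomial (Fin n) 𝕜 ⧸ J)

/-- The edge ideal of a simple graph on the vertices `1, …, n`. -/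
noncomputable def edgeIdeal (𝕜 : Type*) [Field 𝕜] {n : ℕ} (G : SimpleGraph (Fin n)) :
    Ideal (MvPolynomial (Fin n) 𝕜) :=
  Ideal.span {f | ∃ i j, G.Adj i j ∧ f = MvPolynomial.X i * MvPolynomial.X j}

/-- The set of strictly increasing maps `π` of the positive integers with `π(m) ≤ n`, written
for the shifted indices `0, 1, 2, …`: the map sends each of the first `m` indices to one of the
first `n`. -/
def Inc (m n : ℕ) : Set (ℕ → ℕ) :=
  {π | StrictMono π ∧ ∀ i < m, π i < n}

/-- The action `x_i ↦ x_{π(i)}` of `π ∈ Inc m n`, as a map `R_m → R_n`. -/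
noncomputable def incAct (𝕜 : Type*) [Field 𝕜] {m n : ℕ} (π : ℕ → ℕ) (hπ : π ∈ Inc m n) :
    MvPolynomial (Fin m) 𝕜 →ₐ[𝕜] MvPolynomial (Fin n) 𝕜 :=
  MvPolynomial.rename fun i : Fin m => (⟨π i, hπ.2 i i.isLt⟩ : Fin n)

/-- The ideal of `R_n` generated by all `π(f)` with `π ∈ Inc m n` and `f ∈ J`. -/
noncomputable def incSpan {𝕜 : Type*} [Field 𝕜] {m : ℕ} (n : ℕ)
    (J : Ideal (MvPolynomial (Fin m) 𝕜)) : Ideal (MvPolynomial (Fin n) 𝕜) :=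
  Ideal.span {g | ∃ (π : ℕ → ℕ) (hπ : π ∈ Inc m n), ∃ f ∈ J, g = incAct 𝕜 π hπ f}

section Chain

variable {𝕜 : Type*} [Field 𝕜] (I : ∀ n : ℕ, Ideal (MvPolynomial (Fin n) 𝕜))

/-- The chain `(I_n)_{n ≥ 1}` is invariant under increasing maps (the value at `0` is ignored). -/
def IsIncInvariant : Prop :=
  ∀ m n : ℕ, 1 ≤ m → m ≤ n → incSpan n (I m) ≤ I n

/-- The stability index of the chain `(I_n)_{n ≥ 1}`: the least `r ≥ 1` such that
`⟨Inc_{m,n}(I_m)⟩ = I_n` whenever `n ≥ m ≥ r`. -/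
noncomputable def stabilityIndex : ℕ :=
  sInf {r : ℕ | 1 ≤ r ∧ ∀ m n : ℕ, r ≤ m → m ≤ n → incSpan n (I m) = I n}

end Chain

section Support

variable {𝕜 : Type*} [Field 𝕜] {n : ℕ} (J : Ideal (MvPolynomial (Fin n) 𝕜))

/-- The exponent vectors of the minimal monomial generators of a monomial ideal `J`: the
monomials of `J` that are minimal with respect to divisibility. -/
def minGens : Set (Fin n →₀ ℕ) :=
  {a | Minimal (fun b : Fin n →₀ ℕ => MvPolynomial.monomial b (1 : 𝕜) ∈ J) a}

/-- The indices (in `1, …, n`) of the variables dividing some minimal monomial generator. -/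
def suppIndices : Set ℕ :=
  {t | ∃ a ∈ minGens J, ∃ i : Fin n, a i ≠ 0 ∧ t = (i : ℕ) + 1}

/-- The smallest index in the support. -/
noncomputable def minSupp : ℕ := sInf (suppIndices J)

/-- The largest index in the support. -/
noncomputable def maxSupp : ℕ := sSup (suppIndices J)

/-- The width of the support: largest index minus smallest index plus one. -/
noncomputable def suppWidth : ℕ := maxSupp J - minSupp J + 1

end Support

/-- The sparsity index of a graph on `1, …, n` (equivalently of its edge ideal): the minimum of
`j - i` over all edges `{i, j}` with `i < j`. -/
noncomputable def sparsityIndex {n : ℕ} (G : SimpleGraph (Fin n)) : ℕ :=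
  sInf {d | ∃ i j : Fin n, i < j ∧ G.Adj i j ∧ d = (j : ℕ) - (i : ℕ)}

end IncChain

/-! Let `p` and `i₁` be the extreme support indices of `I_r`. By stability every edge of `G_n` is
the image of an edge of `G_r` under an increasing map. Such a map never moves an index left, never
shrinks a gap, and must fit the `r - p` indices after `p` below `n`. So all edges of `G_n` lie in an
interval that leaves `r - rt` vertices isolated, and join vertices at distance at least `sp`.

The isolated variables form a regular sequence. Modulo them the ring is a Stanley-Reisner ring with
a nonempty vertex set, so the sum of all variables is again regular (`isRegularMod_sum_X`). If `sp ≥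
2`, consecutive vertices are non-adjacent, so the independence complex is connected. Connectedness
makes the socle vanish after dividing by the sum (`mem_of_forall_X_mul_mem`), which yields one more
regular element. -/

namespace IncChain

open MvPolynomial RingTheory.Sequence

/-! ### Regular sequences on `R ⧸ J` in terms of ideals. -/

section RegularSequences

variable {R : Type*} [CommRing R]

/-- `x` is a nonzerodivisor modulo the ideal `J`. -/
def IsRegularMod (J : Ideal R) (x : R) : Prop :=
  ∀ g, x * g ∈ J → g ∈ J

lemma mem_smul_top_quotient_iff (J Q : Ideal R) (g : R) :
    Ideal.Quotient.mk J g ∈ (Q • ⊤ : Submodule R (R ⧸ J)) ↔ g ∈ J ⊔ Q := by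
  have h : (Q • ⊤ : Submodule R (R ⧸ J)) = Submodule.map J.mkQ Q := by
    rw [← Submodule.range_mkQ J, LinearMap.range_eq_map, ← Submodule.map_smul'']
    simp
  rw [h]
  constructor
  · rintro ⟨q, hq, hqg⟩
    have : g - q ∈ J := Ideal.Quotient.eq.mp hqg.symm
    rw [← sub_add_cancel g q]
    exact add_mem (Ideal.mem_sup_left this) (Ideal.mem_sup_right hq)
  · intro hg
    obtain ⟨a, ha, b, hb, rfl⟩ := Submodule.mem_sup.mp hg
    refine ⟨b, hb, ?_⟩
    exact (Ideal.Quotient.eq.mpr (by simpa using ha)).symm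

lemma isWeaklyRegular_quotient_of_isRegularMod {J : Ideal R} {rs : List R}
    (h : ∀ i (hi : i < rs.length), IsRegularMod (J ⊔ Ideal.ofList (rs.take i)) rs[i]) :
    IsWeaklyRegular (R ⧸ J) rs := by
  refine ⟨fun i hi => ?_⟩
  rw [isSMulRegular_quotient_iff_mem_of_smul_mem]
  intro x hx
  obtain ⟨g, rfl⟩ := Ideal.Quotient.mk_surjective x
  have hx' : Ideal.Quotient.mk J (rs[i] * g) ∈
      (Ideal.ofList (rs.take i) • ⊤ : Submodule R (R ⧸ J)) := hx
  rw [mem_smul_top_quotient_iff] at hx' ⊢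
  exact h i hi g hx'

/-- Weak regularity suffices: `J` and `rs` lie in the proper ideal `m`, so the final quotient is
nonzero. -/
lemma length_le_depth {J m : Ideal R} {rs : List R} (hm : m ≠ ⊤) (hJ : J ≤ m)
    (hrs : ∀ x ∈ rs, x ∈ m)
    (h : ∀ i (hi : i < rs.length), IsRegularMod (J ⊔ Ideal.ofList (rs.take i)) rs[i]) :
    (rs.length : ℕ∞) ≤ depth m (R ⧸ J) := by
  refine le_iSup₂_of_le rs ⟨hrs, isWeaklyRegular_quotient_of_isRegularMod h, fun htop => ?_⟩ le_rfl
  have h1 : Ideal.Quotient.mk J 1 ∈ (Ideal.ofList rs • ⊤ : Submodule R (R ⧸ J)) :=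
    htop ▸ Submodule.mem_top
  rw [mem_smul_top_quotient_iff] at h1
  exact hm ((Ideal.eq_top_iff_one m).mpr (sup_le hJ (Ideal.span_le.mpr hrs) h1))

/-- A map `R ⧸ m → R ⧸ Q` is determined by a socle element, the image of `1`. Over a Noetherian
ring, vanishing of this Hom gives a nonzerodivisor in `m`. -/
lemma exists_isRegularMod_of_socle_eq_zero [IsNoetherianRing R] {Q m : Ideal R}
    (h : ∀ g, (∀ y ∈ m, y * g ∈ Q) → g ∈ Q) : ∃ f ∈ m, IsRegularMod Q f := by
  have hs : Subsingleton ((R ⧸ m) →ₗ[R] (R ⧸ Q)) := by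
    refine subsingleton_of_forall_eq 0 fun φ => ?_
    obtain ⟨g, hg⟩ := Ideal.Quotient.mk_surjective (φ (Ideal.Quotient.mk m 1))
    have hgQ : g ∈ Q := by
      refine h g fun y hy => ?_
      rw [← Ideal.Quotient.eq_zero_iff_mem]
      have h2 : y • Ideal.Quotient.mk m 1 = 0 := by
        change Ideal.Quotient.mk m (y * 1) = 0
        rw [Ideal.Quotient.eq_zero_iff_mem]
        simpa using hy
      change y • Ideal.Quotient.mk Q g = 0
      rw [hg, ← map_smul, h2, map_zero]
    refine LinearMap.ext fun x => ?_
    obtain ⟨a, rfl⟩ := Ideal.Quotient.mk_surjective x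
    have h3 : Ideal.Quotient.mk m a = a • Ideal.Quotient.mk m 1 := by
      change Ideal.Quotient.mk m a = Ideal.Quotient.mk m (a * 1)
      rw [mul_one]
    rw [h3, map_smul, ← hg, Ideal.Quotient.eq_zero_iff_mem.mpr hgQ, smul_zero,
      LinearMap.zero_apply]
  obtain ⟨f, hf, hreg⟩ := IsSMulRegular.subsingleton_linearMap_iff.mp hs
  rw [Ideal.annihilator_quotient] at hf
  refine ⟨f, hf, fun g hg => ?_⟩
  exact (isSMulRegular_quotient_iff_mem_of_smul_mem Q f).mp hreg g hg

end RegularSequences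

/-! ### Stanley-Reisner ideals of independence complexes. -/

section StanleyReisner

variable {σ : Type*} (G : SimpleGraph σ) (F : Set σ)

/-- The support of the exponent vector `a` is independent in `G` and avoids `F`. -/
def IsFace (a : σ →₀ ℕ) : Prop :=
  (∀ i, a i ≠ 0 → i ∉ F) ∧ ∀ i j, a i ≠ 0 → a j ≠ 0 → ¬ G.Adj i j

variable {G F}

lemma IsFace.of_support_le {a b : σ →₀ ℕ} (hb : IsFace G F b) (h : ∀ i, a i ≠ 0 → b i ≠ 0) :
    IsFace G F a :=
  ⟨fun i hi => hb.1 i (h i hi), fun i j hi hj => hb.2 i j (h i hi) (h j hj)⟩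

lemma IsFace.add_single_of_ne {a : σ →₀ ℕ} {i : σ} (ha : IsFace G F a) (hi : a i ≠ 0) (m : ℕ) :
    IsFace G F (a + Finsupp.single i m) :=
  ha.of_support_le fun j hj hj0 => by
    classical
    rw [Finsupp.add_apply, hj0, zero_add, Finsupp.single_apply] at hj
    by_cases hij : i = j
    · exact hi (hij ▸ hj0)
    · simp [hij] at hj

lemma isFace_single {i : σ} (hi : i ∉ F) (m : ℕ) : IsFace G F (Finsupp.single i m) := by
  classical
  have key : ∀ j, Finsupp.single i m j ≠ 0 → j = i := fun j hj => by
    by_contra hne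
    exact hj (Finsupp.single_eq_of_ne hne)
  refine ⟨fun j hj => key j hj ▸ hi, fun j k hj hk => ?_⟩
  rw [key j hj, key k hk]
  exact G.loopless.irrefl i

variable (𝕜 : Type*) [Field 𝕜] (G F)

/-- The squarefree monomial ideal generated by the edges of `G` and the variables in `F`. -/
noncomputable def nonfaceIdeal : Ideal (MvPolynomial σ 𝕜) :=
  Ideal.span {f | ∃ i j, G.Adj i j ∧ f = X i * X j} ⊔ Ideal.span (X '' F)

variable {𝕜 G F}

/-- Membership in a monomial ideal is checked monomial by monomial, which turns the later arguments
into comparisons of coefficients. -/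
lemma mem_nonfaceIdeal {p : MvPolynomial σ 𝕜} :
    p ∈ nonfaceIdeal G F 𝕜 ↔ ∀ a, IsFace G F a → coeff a p = 0 := by
  classical
  have h : nonfaceIdeal G F 𝕜 = Ideal.span ((fun s => monomial s (1 : 𝕜)) ''
      ({a | ∃ i j, G.Adj i j ∧ a = Finsupp.single i 1 + Finsupp.single j 1} ∪
        (fun i => Finsupp.single i 1) '' F)) := by
    rw [Set.image_union, Ideal.span_union, nonfaceIdeal, Set.image_image]
    congr 2
    ext f
    constructor
    · rintro ⟨i, j, hij, rfl⟩
      exact ⟨_, ⟨i, j, hij, rfl⟩, by simp [X, monomial_mul]⟩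
    · rintro ⟨_, ⟨i, j, hij, rfl⟩, rfl⟩
      exact ⟨i, j, hij, by simp [X, monomial_mul]⟩
  rw [h, mem_ideal_span_monomial_image]
  constructor
  · intro hp a ha
    by_contra hne
    obtain ⟨s, hs, hsa⟩ := hp a (mem_support_iff.mpr hne)
    rcases hs with ⟨i, j, hij, rfl⟩ | ⟨i, hi, rfl⟩
    · have h1 := hsa i
      have h2 := hsa j
      simp only [Finsupp.add_apply, Finsupp.single_eq_same] at h1 h2
      exact ha.2 i j (by omega) (by omega) hij
    · have h1 := hsa i
      simp only [Finsupp.single_eq_same] at h1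
      exact ha.1 i (by omega) hi
  · intro hp a ha
    have hna : ¬ IsFace G F a := fun hf => mem_support_iff.mp ha (hp a hf)
    by_contra! hcon
    refine hna ⟨fun i hi hiF => hcon _ (Or.inr ⟨i, hiF, rfl⟩) ?_, fun i j hi hj hij =>
      hcon _ (Or.inl ⟨i, j, hij, rfl⟩) ?_⟩
    · simpa [Nat.one_le_iff_ne_zero] using hi
    · intro k
      have hne := hij.ne
      simp only [Finsupp.add_apply, Finsupp.single_apply]
      by_cases h1 : i = k
      · subst h1
        simp only [if_true, if_neg hne.symm]
        omega
      · by_cases h2 : j = k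
        · subst h2
          simp only [if_true, if_neg hne]
          omega
        · simp [h1, h2]

lemma isRegularMod_X {v : σ} (hv : ∀ u, ¬ G.Adj v u) (hF : v ∉ F) :
    IsRegularMod (nonfaceIdeal G F 𝕜) (X v) := by
  classical
  intro g hg
  rw [mem_nonfaceIdeal] at hg ⊢
  intro a ha
  rw [← coeff_X_mul a v g]
  have key : ∀ i, (Finsupp.single v 1 + a : σ →₀ ℕ) i ≠ 0 → i = v ∨ a i ≠ 0 := fun i hi => by
    by_cases h : v = i
    · exact Or.inl h.symm
    · right
      simpa [Finsupp.single_apply, h] using hi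
  refine hg _ ⟨fun i hi => ?_, fun i j hi hj hij => ?_⟩
  · rcases key i hi with rfl | h
    · exact hF
    · exact ha.1 i h
  · rcases key i hi with rfl | h
    · exact hv j hij
    · rcases key j hj with rfl | h'
      · exact hv i hij.symm
      · exact ha.2 i j h h' hij

/-- Modulo a squarefree monomial ideal other than the maximal ideal, the sum of all variables is a
nonzerodivisor: it lies in none of the face primes. -/
lemma isRegularMod_sum_X [Fintype σ] (hF : ∃ v, v ∉ F) :
    IsRegularMod (nonfaceIdeal G F 𝕜) (∑ i, X i) := by
  classical
  intro g hg
  rw [mem_nonfaceIdeal] at hg ⊢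
  by_contra! hcon
  obtain ⟨a, ha, hag⟩ := hcon
  -- The face is taken nonempty, even for `a = 0`, so that some variable survives on it.
  obtain ⟨b, hb, hab, v, hbv⟩ :
      ∃ b, IsFace G F b ∧ (∀ i, a i ≠ 0 → b i ≠ 0) ∧ ∃ v, b v ≠ 0 := by
    by_cases h0 : a = 0
    · obtain ⟨v, hv⟩ := hF
      exact ⟨Finsupp.single v 1, isFace_single hv 1, by simp [h0], v, by simp⟩
    · exact ⟨a, ha, fun _ h => h, by simpa [Finsupp.ext_iff] using h0⟩
  -- the quotient map onto the coordinate ring of the face `b`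
  let φ : MvPolynomial σ 𝕜 →ₐ[𝕜] MvPolynomial σ 𝕜 := aeval fun i => if b i ≠ 0 then X i else 0
  have hmon : ∀ c : σ →₀ ℕ, ∀ t : 𝕜, φ (monomial c t) =
      if ∀ i, c i ≠ 0 → b i ≠ 0 then monomial c t else 0 := fun c t => by
    rw [aeval_monomial]
    split_ifs with hc
    · rw [monomial_eq, algebraMap_eq]
      congr 1
      refine Finsupp.prod_congr fun i hi => ?_
      rw [if_pos (hc i (Finsupp.mem_support_iff.mp hi))]
    · push Not at hc
      obtain ⟨i, hi, hbi⟩ := hc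
      rw [Finsupp.prod, Finset.prod_eq_zero (Finsupp.mem_support_iff.mpr hi), mul_zero]
      simp [hbi, hi]
  have hcoeff : ∀ p : MvPolynomial σ 𝕜, ∀ c : σ →₀ ℕ, coeff c (φ p) =
      if ∀ i, c i ≠ 0 → b i ≠ 0 then coeff c p else 0 := fun p c => by
    induction p using MvPolynomial.induction_on' with
    | monomial d t =>
      rw [hmon, coeff_monomial]
      by_cases hdc : d = c
      · subst hdc
        split_ifs <;> simp_all
      · split_ifs <;> simp_all
    | add p q hp hq =>
      rw [map_add, coeff_add, hp, hq, coeff_add]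
      split_ifs <;> simp
  -- `φ` kills the nonface ideal and lands in a domain, yet neither factor dies: the sum keeps `X v`
  -- and `g` keeps its coefficient at `a`.
  have h1 : φ ((∑ i, X i) * g) = 0 := by
    ext c
    rw [hcoeff, coeff_zero]
    split_ifs with hc
    · exact hg c (hb.of_support_le hc)
    · rfl
  rw [map_mul] at h1
  rcases mul_eq_zero.mp h1 with h | h
  · have h2 := hcoeff (∑ i, X i) (Finsupp.single v 1)
    rw [h, if_pos, coeff_zero, coeff_sum] at h2
    · simp only [coeff_X, Finsupp.single_left_inj (one_ne_zero' ℕ)] at h2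
      simp at h2
    · intro i hi
      by_cases hiv : v = i
      · exact hiv ▸ hbv
      · simp [hiv] at hi
  · have h2 := hcoeff g a
    rw [h, if_pos hab, coeff_zero] at h2
    exact hag h2.symm

end StanleyReisner

/-! ### Connectedness and the socle modulo the sum of the variables. -/

section StanleyReisner

variable {σ : Type*} {G : SimpleGraph σ} {F : Set σ} {𝕜 : Type*} [Field 𝕜]

/-- If the independence complex is connected and has at least two vertices, then every
homomorphism from the maximal ideal to the Stanley-Reisner ring is multiplication by an element. -/
lemma exists_sub_X_mul_mem [Fintype σ] (hconn : (Gᶜ.induce Fᶜ).Preconnected)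
    (hnt : ∀ i, ∃ j, j ≠ i ∧ j ∉ F) {h : σ → MvPolynomial σ 𝕜}
    (hh : ∀ i j, X j * h i - X i * h j ∈ nonfaceIdeal G F 𝕜) :
    ∃ q, ∀ i, h i - X i * q ∈ nonfaceIdeal G F 𝕜 := by
  classical
  have hcomp : ∀ i j b, IsFace G F b → coeff b (X j * h i) = coeff b (X i * h j) := fun i j b hb => by
    have := mem_nonfaceIdeal.mp (hh i j) b hb
    rwa [coeff_sub, sub_eq_zero] at this
  have hzero : ∀ i b, IsFace G F b → b i = 0 → coeff b (h i) = 0 := fun i b hb hbi => by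
    obtain ⟨j, hji, hbj⟩ : ∃ j, j ≠ i ∧ IsFace G F (b + Finsupp.single j 1) := by
      by_cases h0 : b = 0
      · obtain ⟨j, hji, hj⟩ := hnt i
        exact ⟨j, hji, by simpa [h0] using isFace_single hj 1⟩
      · obtain ⟨j, hj⟩ : ∃ j, b j ≠ 0 := by simpa [Finsupp.ext_iff] using h0
        exact ⟨j, fun hji => hj (hji ▸ hbi), hb.add_single_of_ne hj 1⟩
    rw [← coeff_X_mul b j (h i), add_comm, hcomp i j _ hbj, coeff_X_mul', if_neg]
    simp [hbi, Finsupp.single_eq_of_ne hji.symm]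
  have hpair : ∀ a i j, IsFace G F (a + Finsupp.single i 1 + Finsupp.single j 1) →
      coeff (a + Finsupp.single i 1) (h i) = coeff (a + Finsupp.single j 1) (h j) :=
    fun a i j hf => by
      rw [← coeff_X_mul _ j (h i), ← coeff_X_mul _ i (h j), add_comm, hcomp i j _ hf]
      congr 1
      abel
  -- For `a = 0` the value is carried along a walk of non-edges, the only use of connectedness;
  -- otherwise both sides are compared through a vertex of the support of `a`.
  have hindep : ∀ a i j, IsFace G F (a + Finsupp.single i 1) → IsFace G F (a + Finsupp.single j 1) →
      coeff (a + Finsupp.single i 1) (h i) = coeff (a + Finsupp.single j 1) (h j) := by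
    intro a i j hi hj
    by_cases h0 : a = 0
    · subst h0
      have hiF : i ∉ F := hi.1 i (by simp)
      have hjF : j ∉ F := hj.1 j (by simp)
      obtain ⟨w⟩ := hconn ⟨i, hiF⟩ ⟨j, hjF⟩
      suffices H : ∀ (u v : ↥Fᶜ), (Gᶜ.induce Fᶜ).Walk u v →
          coeff (0 + Finsupp.single (u : σ) 1) (h u) = coeff (0 + Finsupp.single (v : σ) 1) (h v) from
        H _ _ w
      intro u v p
      induction p with
      | nil => rfl
      | @cons u v _ huv _ ih =>
        refine (hpair 0 u v ?_).trans ih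
        have hna : ¬ G.Adj u v := (SimpleGraph.compl_adj G _ _).mp huv |>.2
        have key : ∀ k, (0 + Finsupp.single (u : σ) 1 + Finsupp.single (v : σ) 1 : σ →₀ ℕ) k ≠ 0 →
            k = u ∨ k = v := fun k hk => by
          by_contra! hne
          simp [Finsupp.single_eq_of_ne hne.1, Finsupp.single_eq_of_ne hne.2] at hk
        refine ⟨fun k hk => ?_, fun k l hk hl hkl => ?_⟩
        · rcases key k hk with rfl | rfl
          exacts [u.2, v.2]
        · rcases key k hk with rfl | rfl <;> rcases key l hl with rfl | rfl
          exacts [hkl.ne rfl, hna hkl, hna hkl.symm, hkl.ne rfl]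
    · obtain ⟨k, hk⟩ : ∃ k, a k ≠ 0 := by simpa [Finsupp.ext_iff] using h0
      rw [hpair a i k (hi.add_single_of_ne (by simp [hk]) 1),
        hpair a j k (hj.add_single_of_ne (by simp [hk]) 1)]
  -- The coefficients of `q`: the coefficient of `h i` at `a + eᵢ`, independent of `i` by `hindep`.
  let c : (σ →₀ ℕ) → 𝕜 := fun a =>
    if H : ∃ i, IsFace G F (a + Finsupp.single i 1) then
      coeff (a + Finsupp.single H.choose 1) (h H.choose) else 0
  have hc : ∀ a i, IsFace G F (a + Finsupp.single i 1) →
      c a = coeff (a + Finsupp.single i 1) (h i) := fun a i hi => by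
    have H : ∃ i, IsFace G F (a + Finsupp.single i 1) := ⟨i, hi⟩
    simp only [c, dif_pos H]
    exact hindep a _ _ H.choose_spec hi
  let T : Finset (σ →₀ ℕ) :=
    Finset.univ.biUnion fun i => (h i).support.image fun b => b - Finsupp.single i 1
  refine ⟨∑ a ∈ T, monomial a (c a), fun i => mem_nonfaceIdeal.mpr fun b hb => ?_⟩
  rw [coeff_sub, sub_eq_zero]
  by_cases hbi : b i = 0
  · rw [hzero i b hb hbi, coeff_X_mul', if_neg (by simpa using hbi)]
  · obtain ⟨a, rfl⟩ : ∃ a, b = a + Finsupp.single i 1 :=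
      ⟨b - Finsupp.single i 1, (tsub_add_cancel_of_le
        (by simpa [Nat.one_le_iff_ne_zero] using hbi)).symm⟩
    conv_rhs => rw [add_comm, coeff_X_mul, coeff_sum]
    simp only [coeff_monomial, Finset.sum_ite_eq']
    split_ifs with ha
    · exact (hc a i hb).symm
    · by_contra hne
      refine ha (Finset.mem_biUnion.mpr ⟨i, Finset.mem_univ i, Finset.mem_image.mpr
        ⟨_, mem_support_iff.mpr hne, by simp⟩⟩)

/-- Put `s = ∑ X i` and `X i * g ≡ s * h i`. Cancelling `s` gives `X j * h i ≡ X i * h j`, so `h i ≡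
X i * q`. Summing over `i` gives `s * g ≡ s * (s * q)`, whence `g ≡ s * q`. -/
lemma mem_of_forall_X_mul_mem [Fintype σ] (hconn : (Gᶜ.induce Fᶜ).Preconnected)
    (hnt : ∀ i, ∃ j, j ≠ i ∧ j ∉ F) {g : MvPolynomial σ 𝕜} (hF : ∃ v, v ∉ F)
    (hg : ∀ i, X i * g ∈ nonfaceIdeal G F 𝕜 ⊔ Ideal.span {∑ i, X i}) :
    g ∈ nonfaceIdeal G F 𝕜 ⊔ Ideal.span {∑ i, X i} := by
  have hreg := isRegularMod_sum_X (𝕜 := 𝕜) (G := G) hF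
  have hex : ∀ i, ∃ h, X i * g - (∑ i, X i) * h ∈ nonfaceIdeal G F 𝕜 := fun i => by
    obtain ⟨k, hk, l, hl, hkl⟩ := Submodule.mem_sup.mp (hg i)
    obtain ⟨h, rfl⟩ := Ideal.mem_span_singleton'.mp hl
    refine ⟨h, ?_⟩
    rw [← hkl, mul_comm h, add_sub_cancel_right]
    exact hk
  choose h hh using hex
  obtain ⟨q, hq⟩ := exists_sub_X_mul_mem (h := h) hconn hnt fun i j => by
    refine hreg _ ?_
    have := sub_mem (Ideal.mul_mem_left _ (X i) (hh j)) (Ideal.mul_mem_left _ (X j) (hh i))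
    convert this using 1
    ring
  have hmem : g - (∑ i, X i) * q ∈ nonfaceIdeal G F 𝕜 := by
    refine hreg _ ?_
    rw [Finset.sum_mul]
    refine Ideal.sum_mem _ fun i _ => ?_
    have := add_mem (hh i) (Ideal.mul_mem_left _ (∑ i, X i) (hq i))
    convert this using 1
    ring
  rw [← sub_add_cancel g ((∑ i, X i) * q)]
  exact add_mem (Ideal.mem_sup_left hmem)
    (Ideal.mem_sup_right (Ideal.mul_mem_right _ _ (Ideal.mem_span_singleton_self _)))

end StanleyReisner

/-! ### Depth bounds from isolated vertices. -/

section Depth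

variable {𝕜 : Type*} [Field 𝕜] {n : ℕ} {G : SimpleGraph (Fin n)}

lemma X_mem_maxIdeal (i : Fin n) : (X i : MvPolynomial (Fin n) 𝕜) ∈ maxIdeal 𝕜 n :=
  Ideal.subset_span ⟨i, rfl⟩

lemma maxIdeal_ne_top : maxIdeal 𝕜 n ≠ ⊤ := by
  rw [Ideal.ne_top_iff_one]
  intro h
  have hle : maxIdeal 𝕜 n ≤ RingHom.ker (constantCoeff (R := 𝕜) (σ := Fin n)) := by
    refine Ideal.span_le.mpr ?_
    rintro _ ⟨i, rfl⟩
    simp [RingHom.mem_ker]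
  have := hle h
  simp [RingHom.mem_ker] at this

lemma edgeIdeal_le_maxIdeal : edgeIdeal 𝕜 G ≤ maxIdeal 𝕜 n := by
  refine Ideal.span_le.mpr ?_
  rintro _ ⟨i, j, -, rfl⟩
  exact Ideal.mul_mem_left _ _ (X_mem_maxIdeal j)

lemma edgeIdeal_sup_ofList_map_X (l : List (Fin n)) :
    edgeIdeal 𝕜 G ⊔ Ideal.ofList (l.map X) = nonfaceIdeal G {v | v ∈ l} 𝕜 := by
  have : {x | x ∈ l.map (X (R := 𝕜))} = X '' {v | v ∈ l} := by
    ext; simp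
  rw [nonfaceIdeal, edgeIdeal, Ideal.ofList, this]

/-- Dividing by variables keeps the ideal of the form `nonfaceIdeal`, and an isolated variable not
yet killed is regular there. -/
lemma isRegularMod_isolated_append {l : List (Fin n)} (hl : l.Nodup)
    (hiso : ∀ v ∈ l, ∀ u, ¬ G.Adj v u) (t : List (MvPolynomial (Fin n) 𝕜))
    (ht : ∀ i (hi : i < t.length), IsRegularMod
      (nonfaceIdeal G {v | v ∈ l} 𝕜 ⊔ Ideal.ofList (t.take i)) t[i]) :
    ∀ i (hi : i < (l.map X ++ t).length),
      IsRegularMod (edgeIdeal 𝕜 G ⊔ Ideal.ofList ((l.map X ++ t).take i)) (l.map X ++ t)[i] := by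
  intro i hi
  by_cases hil : i < l.length
  · rw [List.take_append_of_le_length (by simpa using hil.le), ← List.map_take,
      edgeIdeal_sup_ofList_map_X, List.getElem_append_left (by simpa using hil), List.getElem_map]
    refine isRegularMod_X (hiso _ (List.getElem_mem hil)) fun hmem => ?_
    obtain ⟨k, hk, hki⟩ := List.mem_take_iff_getElem.mp hmem
    have := (hl.getElem_inj_iff).mp hki
    omega
  · have hlen : (l.map (X (R := 𝕜))).length = l.length := List.length_map _
    rw [List.take_append, List.take_of_length_le (by omega), Ideal.ofList_append, ← sup_assoc,
      edgeIdeal_sup_ofList_map_X, List.getElem_append_right (by omega)]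
    simp only [hlen]
    exact ht _ _

lemma card_add_one_le_depthQuot_edgeIdeal {S : Finset (Fin n)}
    (hS : ∀ v ∈ S, ∀ u, ¬ G.Adj v u) (hne : ∃ v, v ∉ S) :
    ((S.card + 1 : ℕ) : ℕ∞) ≤ depthQuot (edgeIdeal 𝕜 G) := by
  have h := length_le_depth (J := edgeIdeal 𝕜 G) (m := maxIdeal 𝕜 n)
    (rs := S.toList.map X ++ [∑ i, X i]) maxIdeal_ne_top edgeIdeal_le_maxIdeal ?_
    (isRegularMod_isolated_append S.nodup_toList (by simpa using hS) _ ?_)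
  · simpa [depthQuot] using h
  · simp only [List.mem_append, List.mem_map, List.mem_singleton]
    rintro _ (⟨i, -, rfl⟩ | rfl)
    exacts [X_mem_maxIdeal i, Ideal.sum_mem _ fun i _ => X_mem_maxIdeal i]
  · intro i hi
    obtain rfl : i = 0 := by simpa using hi
    simpa using isRegularMod_sum_X (by simpa using hne)

lemma card_add_two_le_depthQuot_edgeIdeal {S : Finset (Fin n)}
    (hS : ∀ v ∈ S, ∀ u, ¬ G.Adj v u) (hne : ∀ i, ∃ j, j ≠ i ∧ j ∉ S) (hne' : ∃ v, v ∉ S)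
    (hconn : (Gᶜ.induce {v | v ∉ S}).Preconnected) :
    ((S.card + 2 : ℕ) : ℕ∞) ≤ depthQuot (edgeIdeal 𝕜 G) := by
  set F : Set (Fin n) := {v | v ∈ S.toList} with hF
  have hFc : Fᶜ = {v | v ∉ S} := by ext; simp [hF]
  have hmF : ∀ v, v ∉ F ↔ v ∉ S := by simp [hF]
  obtain ⟨f, hf, hreg⟩ := exists_isRegularMod_of_socle_eq_zero
    (Q := nonfaceIdeal G F 𝕜 ⊔ Ideal.span {∑ i, X i}) (m := maxIdeal 𝕜 n)
    fun g hg => mem_of_forall_X_mul_mem (by rwa [hFc]) (by simpa [hmF] using hne)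
      (by simpa [hmF] using hne') fun i => hg _ (X_mem_maxIdeal i)
  have h := length_le_depth (J := edgeIdeal 𝕜 G) (m := maxIdeal 𝕜 n)
    (rs := S.toList.map X ++ [∑ i, X i, f]) maxIdeal_ne_top edgeIdeal_le_maxIdeal ?_
    (isRegularMod_isolated_append S.nodup_toList (by simpa using hS) _ ?_)
  · simpa [depthQuot] using h
  · simp only [List.mem_append, List.mem_map, List.mem_cons, List.not_mem_nil, or_false]
    rintro _ (⟨i, -, rfl⟩ | rfl | rfl)
    exacts [X_mem_maxIdeal i, Ideal.sum_mem _ fun i _ => X_mem_maxIdeal i, hf]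
  · intro i hi
    have hi' : i < 2 := hi
    interval_cases i
    · simpa using isRegularMod_sum_X (by simpa using hne')
    · simpa [Ideal.ofList_singleton, hF] using hreg

end Depth

/-! ### Edges along the chain, supports, and graphs confined to an interval. -/

section EdgeIdeals

variable {𝕜 : Type*} [Field 𝕜]

lemma incSpan_bot {m : ℕ} (n : ℕ) : incSpan n (⊥ : Ideal (MvPolynomial (Fin m) 𝕜)) = ⊥ := by
  refine Ideal.span_eq_bot.mpr ?_
  rintro _ ⟨π, hπ, f, hf, rfl⟩
  rw [Ideal.mem_bot.mp hf, map_zero]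

lemma exists_adj_of_edgeIdeal_ne_bot {n : ℕ} {G : SimpleGraph (Fin n)}
    (h : edgeIdeal 𝕜 G ≠ ⊥) : ∃ i j, i < j ∧ G.Adj i j := by
  by_contra! hcon
  refine h (Ideal.span_eq_bot.mpr ?_)
  rintro _ ⟨i, j, hij, rfl⟩
  rcases lt_or_gt_of_ne hij.ne with hlt | hlt
  exacts [(hcon i j hlt hij).elim, (hcon j i hlt hij.symm).elim]

/-- Every edge of a graph whose edge ideal is generated by the images of another edge ideal is
itself the image of an edge. -/
lemma exists_adj_of_edgeIdeal_eq_incSpan {m n : ℕ} {H : SimpleGraph (Fin m)}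
    {G : SimpleGraph (Fin n)} (h : incSpan n (edgeIdeal 𝕜 H) = edgeIdeal 𝕜 G) {u v : Fin n}
    (huv : u < v) (hadj : G.Adj u v) :
    ∃ π ∈ Inc m n, ∃ i j : Fin m, i < j ∧ H.Adj i j ∧ π i = u ∧ π j = v := by
  classical
  by_contra! hcon
  -- Evaluation at the indicator of `{u, v}` sends `X u * X v` to `1`, but kills the image of every
  -- edge not mapped onto `{u, v}`.
  let φ : MvPolynomial (Fin n) 𝕜 →ₐ[𝕜] 𝕜 := aeval fun k => if k = u ∨ k = v then 1 else 0
  have hle : incSpan n (edgeIdeal 𝕜 H) ≤ RingHom.ker φ := by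
    refine Ideal.span_le.mpr ?_
    rintro _ ⟨π, hπ, f, hf, rfl⟩
    suffices hle' : edgeIdeal 𝕜 H ≤ RingHom.ker (φ.comp (incAct 𝕜 π hπ)) from hle' hf
    have key : ∀ i j : Fin m, i < j → H.Adj i j →
        φ (incAct 𝕜 π hπ (X i)) * φ (incAct 𝕜 π hπ (X j)) = 0 := fun i j hij hadj' => by
      have hπij : π i < π j := hπ.1 hij
      simp only [incAct, rename_X, φ, aeval_X, mul_ite, mul_one, mul_zero, Fin.ext_iff]
      split_ifs with h1 h2
      · have huv' : (u : ℕ) < v := huv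
        exact absurd (by omega) (hcon π hπ i j hij hadj' (by omega))
      all_goals rfl
    refine Ideal.span_le.mpr ?_
    rintro _ ⟨i, j, hij, rfl⟩
    rw [SetLike.mem_coe, RingHom.mem_ker, map_mul]
    rcases lt_or_gt_of_ne hij.ne with hlt | hlt
    · exact key i j hlt hij
    · rw [mul_comm]
      exact key j i hlt hij.symm
  have hmem : (X u * X v : MvPolynomial (Fin n) 𝕜) ∈ incSpan n (edgeIdeal 𝕜 H) :=
    h ▸ Ideal.subset_span ⟨u, v, hadj, rfl⟩
  have := hle hmem
  simp [RingHom.mem_ker, φ] at this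

lemma mem_minGens_of_adj {n : ℕ} {G : SimpleGraph (Fin n)} {i j : Fin n} (hij : G.Adj i j) :
    Finsupp.single i 1 + Finsupp.single j 1 ∈ minGens (edgeIdeal 𝕜 G) := by
  classical
  have hmem : ∀ b : Fin n →₀ ℕ, monomial b (1 : 𝕜) ∈ edgeIdeal 𝕜 G ↔ ¬ IsFace G ∅ b := fun b => by
    have h : edgeIdeal 𝕜 G = nonfaceIdeal G ∅ 𝕜 := by simp [nonfaceIdeal, edgeIdeal]
    rw [h, mem_nonfaceIdeal]
    constructor
    · intro hb hf
      simpa using hb b hf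
    · intro hb a ha
      rw [coeff_monomial, if_neg]
      rintro rfl
      exact hb ha
  have hne := hij.ne
  refine ⟨(hmem _).mpr fun hf => hf.2 i j (by simp) (by simp) hij, fun b hb hle => ?_⟩
  have hb' := (hmem b).mp hb
  have hsub : ∀ k, b k ≠ 0 → k = i ∨ k = j := fun k hk => by
    by_contra! hcon
    have := hle k
    simp [Finsupp.single_eq_of_ne hcon.1, Finsupp.single_eq_of_ne hcon.2] at this
    exact hk this
  have hboth : b i ≠ 0 ∧ b j ≠ 0 := by
    by_contra hcon
    refine hb' ⟨fun _ _ => Set.notMem_empty _, fun k l hk hl hkl => hcon ?_⟩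
    rcases hsub k hk with rfl | rfl <;> rcases hsub l hl with rfl | rfl
    exacts [(hkl.ne rfl).elim, ⟨hk, hl⟩, ⟨hl, hk⟩, (hkl.ne rfl).elim]
  intro k
  have h1 := hboth.1
  have h2 := hboth.2
  simp only [Finsupp.add_apply, Finsupp.single_apply]
  by_cases hik : i = k
  · subst hik
    simp only [if_true, if_neg hne.symm]
    omega
  · by_cases hjk : j = k
    · subst hjk
      simp only [if_true, if_neg hne]
      omega
    · simp [hik, hjk]

lemma suppIndices_subset {n : ℕ} (J : Ideal (MvPolynomial (Fin n) 𝕜)) :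
    suppIndices J ⊆ Set.Icc 1 n := by
  rintro _ ⟨a, -, i, -, rfl⟩
  exact ⟨by omega, i.isLt⟩

lemma mem_suppIndices_of_adj {n : ℕ} {G : SimpleGraph (Fin n)} {i j : Fin n} (hij : G.Adj i j) :
    (i : ℕ) + 1 ∈ suppIndices (edgeIdeal 𝕜 G) :=
  ⟨_, mem_minGens_of_adj hij, i, by simp, rfl⟩

/-- If all edges of `G` join vertices of the interval `[lo, hi)`, then the remaining variables and
the sum of all variables form a regular sequence, which can be prolonged once more if consecutive
vertices are never adjacent. -/
lemma le_depthQuot_edgeIdeal {n lo hi d : ℕ} {G : SimpleGraph (Fin n)} (hhi : hi ≤ n)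
    (hlohi : lo + 2 ≤ hi) (hd : d ≤ 2)
    (hG : ∀ u v : Fin n, u < v → G.Adj u v → lo ≤ u ∧ (v : ℕ) < hi ∧ (u : ℕ) + d ≤ v) :
    ((n - (hi - lo) + d : ℕ) : ℕ∞) ≤ depthQuot (edgeIdeal 𝕜 G) := by
  classical
  let S : Finset (Fin n) := Finset.univ.filter fun v => ¬ (lo ≤ (v : ℕ) ∧ (v : ℕ) < hi)
  have hmem : ∀ v : Fin n, v ∉ S ↔ lo ≤ (v : ℕ) ∧ (v : ℕ) < hi := fun v => by simp [S]
  have hcard : n - (hi - lo) ≤ S.card := by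
    have h1 : Sᶜ.card ≤ (Finset.Ico lo hi).card :=
      Finset.card_le_card_of_injOn Fin.val (fun v hv => by
        simpa using (hmem v).mp (Finset.mem_compl.mp hv)) Fin.val_injective.injOn
    rw [Finset.card_compl, Fintype.card_fin, Nat.card_Ico] at h1
    omega
  have hS : ∀ v ∈ S, ∀ u, ¬ G.Adj v u := fun v hv u hvu => by
    refine absurd hv ((hmem v).mpr ?_)
    rcases lt_or_gt_of_ne hvu.ne with hlt | hlt
    · have := hG v u hlt hvu
      have : (v : ℕ) < u := hlt
      omega
    · have := hG u v hlt hvu.symm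
      have : (u : ℕ) < v := hlt
      omega
  have hlo : lo < n := by omega
  have hlo' : lo + 1 < n := by omega
  have hex : ∃ v, v ∉ S := ⟨⟨lo, hlo⟩, (hmem _).mpr ⟨le_rfl, by simp only; omega⟩⟩
  rcases hd.lt_or_eq with hd | rfl
  · refine le_trans ?_ (card_add_one_le_depthQuot_edgeIdeal hS hex)
    exact_mod_cast (by omega : n - (hi - lo) + d ≤ S.card + 1)
  refine le_trans ?_ (card_add_two_le_depthQuot_edgeIdeal hS (fun i => ?_) hex ?_)
  · exact_mod_cast (by omega : n - (hi - lo) + 2 ≤ S.card + 2)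
  · by_cases hi0 : (i : ℕ) = lo
    · exact ⟨⟨lo + 1, hlo'⟩, by simp [Fin.ext_iff, hi0], (hmem _).mpr ⟨by simp, by simp only; omega⟩⟩
    · exact ⟨⟨lo, hlo⟩, fun h => hi0 (h ▸ rfl), (hmem _).mpr ⟨le_rfl, by simp only; omega⟩⟩
  -- Since edges have length at least `2`, the interval is a path `lo, lo + 1, …` in the complement
  -- graph.
  · have hreach : ∀ (k : ℕ) (u v : {v : Fin n | v ∉ S}), (u : ℕ) + k = v →
        (Gᶜ.induce {v | v ∉ S}).Reachable u v := by
      intro k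
      induction k with
      | zero =>
        intro u v huv
        rw [Subtype.ext (Fin.ext huv) (a1 := u) (a2 := v)]
      | succ k ih =>
        intro u v huv
        have hu := (hmem u).mp u.2
        have hv := (hmem v).mp v.2
        have hw : (v : ℕ) - 1 < n := by omega
        let w : {v : Fin n | v ∉ S} :=
          ⟨⟨(v : ℕ) - 1, hw⟩, (hmem _).mpr ⟨by simp only; omega, by simp only; omega⟩⟩
        have hwv : (w : Fin n) < v := by
          rw [Fin.lt_def]
          simp only [w]
          omega
        refine (ih u w (by simp only [w]; omega)).trans (SimpleGraph.Adj.reachable ?_)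
        refine (SimpleGraph.compl_adj G _ _).mpr ⟨hwv.ne, fun hadj => ?_⟩
        have := (hG w v hwv hadj).2.2
        simp only [w] at this
        omega
    intro u v
    rcases le_total (u : ℕ) (v : ℕ) with h | h
    · exact hreach (v - u) u v (by omega)
    · exact (hreach (u - v) v u (by omega)).symm

end EdgeIdeals

end IncChain

/-! ### The depth bound for the chain. -/

theorem theorem4p3 {𝕜 : Type*} [Field 𝕜]
    (I : ∀ n : ℕ, Ideal (MvPolynomial (Fin n) 𝕜))
    (G : ∀ n : ℕ, SimpleGraph (Fin n))
    (hG : ∀ n : ℕ, 1 ≤ n → I n = IncChain.edgeIdeal 𝕜 (G n))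
    (hinv : IncChain.IsIncInvariant I)
    (hne : ∃ N : ℕ, ∀ n : ℕ, N ≤ n → I n ≠ ⊥)
    (r rt sp : ℕ)
    (hr : r = IncChain.stabilityIndex I)
    (hrt : rt = IncChain.suppWidth (I r))
    (hsp : sp = IncChain.sparsityIndex (G r))
    (n : ℕ) (hn : r ≤ n) :
    ((r - rt + min sp 2 : ℕ) : ℕ∞) ≤ IncChain.depthQuot (I n) := by
  open IncChain in
  rcases Nat.eq_zero_or_pos r with rfl | hr0
  · -- the set defining the stability index is then empty, and the bound is zero
    have : sp = 0 := by simp [hsp, sparsityIndex]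
    simp [this]
  have hstab : ∀ k, r ≤ k → incSpan k (I r) = I k := by
    have hmem : r ∈ {r : ℕ | 1 ≤ r ∧ ∀ m n : ℕ, r ≤ m → m ≤ n → incSpan n (I m) = I n} := by
      rw [hr]
      exact Nat.sInf_mem (Nat.nonempty_of_pos_sInf (lt_of_lt_of_eq hr0 hr))
    exact fun k hk => hmem.2 r k le_rfl hk
  have hIr : I r = edgeIdeal 𝕜 (G r) := hG r hr0
  obtain ⟨i₀, j₀, hij₀, hadj₀⟩ : ∃ i j, i < j ∧ (G r).Adj i j := by
    refine exists_adj_of_edgeIdeal_ne_bot (𝕜 := 𝕜) fun hbot => ?_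
    obtain ⟨N, hN⟩ := hne
    refine hN (max N r) (le_max_left _ _) ?_
    rw [← hstab _ (le_max_right _ _), hIr, hbot, incSpan_bot]
  have hbdd : BddAbove (suppIndices (I r)) := ⟨r, fun t ht => (suppIndices_subset _ ht).2⟩
  have hbounds : ∀ i j, i < j → (G r).Adj i j →
      minSupp (I r) ≤ (i : ℕ) + 1 ∧ (j : ℕ) + 1 ≤ maxSupp (I r) ∧ (i : ℕ) + sp ≤ j := by
    intro i j hij hadj
    refine ⟨Nat.sInf_le ?_, le_csSup hbdd ?_, ?_⟩
    · rw [hIr]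
      exact mem_suppIndices_of_adj hadj
    · rw [hIr]
      exact mem_suppIndices_of_adj hadj.symm
    · have h1 : sp ≤ (j : ℕ) - i := hsp ▸ Nat.sInf_le ⟨i, j, hij, hadj, rfl⟩
      have h2 : (i : ℕ) < j := hij
      omega
  have hnonempty : (suppIndices (I r)).Nonempty :=
    ⟨_, by rw [hIr]; exact mem_suppIndices_of_adj hadj₀⟩
  have hmin : 1 ≤ minSupp (I r) := (suppIndices_subset _ (Nat.sInf_mem hnonempty)).1
  have hmax : maxSupp (I r) ≤ r := (suppIndices_subset _ (Nat.sSup_mem hnonempty hbdd)).2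
  have h₀ := hbounds i₀ j₀ hij₀ hadj₀
  have hij₀' : (i₀ : ℕ) < j₀ := hij₀
  rw [suppWidth] at hrt
  rw [hG n (hr0.trans_le hn)]
  -- Support indices start at `1` and `Fin` at `0`, hence the `- 1`. The interval has length `n - (r
  -- - rt)`.
  refine le_trans ?_ (le_depthQuot_edgeIdeal (lo := minSupp (I r) - 1)
    (hi := n - (r - maxSupp (I r))) (d := min sp 2) (by omega) (by omega) (by omega)
    fun u v huv hadj => ?_)
  · exact_mod_cast (by omega)
  · have heq : incSpan n (edgeIdeal 𝕜 (G r)) = edgeIdeal 𝕜 (G n) := by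
      rw [← hIr, hstab n hn, hG n (hr0.trans_le hn)]
    obtain ⟨π, hπ, i, j, hij, hadj', hu, hv⟩ := exists_adj_of_edgeIdeal_eq_incSpan heq huv hadj
    have hb := hbounds i j hij hadj'
    have hij' : (i : ℕ) < j := hij
    have h1 : (i : ℕ) ≤ π i := hπ.1.le_apply
    have h2 := hπ.1.add_le_nat (j - i) i
    -- The indices after `j` up to `r - 1` must still map below `n`, which bounds `π j` from above.
    have h3 := hπ.1.add_le_nat (r - 1 - j) j
    have h4 := hπ.2 (r - 1) (by omega)
    rw [Nat.sub_add_cancel hij'.le] at h2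
    rw [Nat.sub_add_cancel (by omega)] at h3
    omega
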